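/- Let $k$ be a field, let $X$ be a smooth affine variety over $k$ (an integral affine scheme, smooth over $k$), and let $\pi:\tilde X\to X$ be an étale Galois covering with finite Galois group $G$: $\pi$ is finite étale and surjective, $G$ acts on $\tilde X$ over $X$, and the morphism $\coprod_{g\in G}\tilde X\to\tilde X\times_X\tilde X$, equal to $(\mathrm{id},g)$ on the component indexed by $g$, is an isomorphism. Assume that $\tilde X$ is irreducible. Let $Y=(\tilde X\times_k\tilde X)/G$ be the quotient of the affine scheme $\tilde X\times_k\tilde X$ by the diagonal action of $G$, i.e. $Y=\operatorname{Spec}\big(\Gamma(\tilde X\times_k\tilde X,\mathcal O)^G\big)$, and let $p_1,p_2:Y\to X$ be the morphisms induced by the $G$-invariant morphisms $\pi\circ pr_1,\ \pi\circ pr_2:\tilde X\times_k\tilde X\to X$. Let $C(\tilde X/X)$ be the full subcategory of the category of sheaves of abelian groups on the small étale site $X_{et}$ whose objects are the sheaves $F$ that are locally constant constructible (étale locally on $X$ isomorphic to the constant sheaf of a finite abelian group) and for which $\pi^*F$ is a constant sheaf on $\tilde X_{et}$. Write $p_i^*$ for the restriction to $C(\tilde X/X)$ of the pullback functor from sheaves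 of abelian groups on $X_{et}$ to those on $Y_{et}$. Then there is an isomorphism of functors $\Phi:p_1^*\xrightarrow{\ \cong\ }p_2^*$ on $C(\tilde X/X)$: a family of isomorphisms $\Phi_F:p_1^*F\to p_2^*F$, $F\in C(\tilde X/X)$, such that $p_2^*(\alpha)\circ\Phi_{F'}=\Phi_{F''}\circ p_1^*(\alpha)$ for every morphism $\alpha:F'\to F''$ in $C(\tilde X/X)$. -/

import Mathlib

open CategoryTheory Limits AlgebraicGeometry

universe u

namespace FiniteMonodromy

noncomputable section

section EtaleSheaves

/-- The class of étale morphisms of schemes. -/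
abbrev etaleProp : MorphismProperty Scheme.{u} := @Etale

instance : etaleProp.{u}.IsStableUnderBaseChange := Etale.etale_isStableUnderBaseChange

/-- Base change along `f : T ⟶ S` as a functor `S_et ⥤ T_et`, `U ↦ U ×_S T`, between the
underlying categories of the small étale sites. -/
def etaleBaseChange {T S : Scheme.{u}} (f : T ⟶ S) : S.Etale ⥤ T.Etale :=
  MorphismProperty.Over.pullback etaleProp ⊤ f

instance {T S : Scheme.{u}} (f : T ⟶ S) : PreservesFiniteLimits (etaleBaseChange f) :=
  inferInstanceAs (PreservesFiniteLimits (MorphismProperty.Over.pullback etaleProp ⊤ f))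

lemma mem_range_of_pullback {A U S T : Scheme.{u}} {a : A ⟶ U} {v : U ⟶ S} {w : A ⟶ S}
    {f : T ⟶ S} (hw : a ≫ v = w) {b : pullback w f ⟶ pullback v f}
    (h₁ : b ≫ pullback.fst v f = pullback.fst w f ≫ a)
    (h₂ : b ≫ pullback.snd v f = pullback.snd w f)
    {x : ↥(pullback v f)} (hx : pullback.fst v f x ∈ Set.range a) : x ∈ Set.range b := by
  subst hw
  obtain ⟨z, hz⟩ := hx
  have sq : IsPullback (pullback.fst (a ≫ v) f) b a (pullback.fst v f) :=
    IsPullback.of_bot (v₂₁ := pullback.snd v f) (v₂₂ := v) (h₃₁ := f)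
      (by rw [h₂]; exact IsPullback.of_hasPullback _ _) h₁.symm (IsPullback.of_hasPullback _ _)
  obtain ⟨y, -, hy⟩ := Scheme.Pullback.exists_preimage_pullback z x hz
  refine ⟨sq.isoPullback.inv y, ?_⟩
  rw [← hy, ← sq.isoPullback_inv_snd, Scheme.Hom.comp_apply]

lemma coverPreserving_etaleBaseChange {T S : Scheme.{u}} (f : T ⟶ S) :
    CoverPreserving S.smallEtaleTopology T.smallEtaleTopology (etaleBaseChange f) where
  cover_preserve {U R} hR := by
    obtain ⟨ι, Z, g, rfl⟩ := R.exists_eq_ofArrows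
    rw [Scheme.ofArrows_mem_smallEtaleTopology_iff] at hR
    rw [Sieve.functorPushforward_ofArrows, Scheme.ofArrows_mem_smallEtaleTopology_iff]
    refine Set.eq_univ_of_forall fun x => ?_
    obtain ⟨i, hi⟩ := Set.mem_iUnion.1 (hR.ge (Set.mem_univ ((pullback.fst U.hom f) x)))
    exact Set.mem_iUnion.2 ⟨i, mem_range_of_pullback
      (Over.w ((Scheme.Etale.forget S).map (g i)))
      (pullback.lift_fst _ _ _) (pullback.lift_snd _ _ _) hi⟩

instance {T S : Scheme.{u}} (f : T ⟶ S) :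
    (etaleBaseChange f).IsContinuous S.smallEtaleTopology T.smallEtaleTopology :=
  have : RepresentablyFlat (etaleBaseChange f) := flat_of_preservesFiniteLimits _
  Functor.isContinuous_iff_coverPreserving.2 (coverPreserving_etaleBaseChange f)

/-- The pushforward `f_*` of étale sheaves of abelian groups along `f : T ⟶ S`, given by
`(f_* F)(U) = F(U ×_S T)`. -/
abbrev etalePushforward {T S : Scheme.{u}} (f : T ⟶ S) :
    Sheaf T.smallEtaleTopology Ab.{u} ⥤ Sheaf S.smallEtaleTopology Ab.{u} :=
  (etaleBaseChange f).sheafPushforwardContinuous Ab.{u} S.smallEtaleTopology T.smallEtaleTopology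

lemma preservesLimits_etalePushforward {T S : Scheme.{u}} (f : T ⟶ S) :
    PreservesLimitsOfSize.{u, u} (etalePushforward f) :=
  have : PreservesLimitsOfSize.{u, u}
      (etalePushforward f ⋙ sheafToPresheaf S.smallEtaleTopology Ab.{u}) :=
    preservesLimits_of_natIso
      ((etaleBaseChange f).sheafPushforwardContinuousCompSheafToPresheafIso Ab.{u}
        S.smallEtaleTopology T.smallEtaleTopology).symm
  preservesLimits_of_reflects_of_preserves _ (sheafToPresheaf S.smallEtaleTopology Ab.{u})

/-- A form of the special adjoint functor theorem: a functor between Grothendieck abelian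
categories that preserves small limits has a left adjoint. -/
lemma isRightAdjoint_of_isGrothendieckAbelian {C D : Type*} [Category* C] [Category* D]
    [Abelian C] [Abelian D] [IsGrothendieckAbelian.{u} C] [IsGrothendieckAbelian.{u} D]
    (F : C ⥤ D) [PreservesLimitsOfSize.{u, u} F] : F.IsRightAdjoint := by
  let eC := ShrinkHoms.equivalence.{u} C
  let eD := ShrinkHoms.equivalence.{u} D
  let F' := eC.inverse ⋙ F ⋙ eD.functor
  have : F'.IsRightAdjoint :=
    isRightAdjoint_of_preservesLimits_of_isCoseparating.{u} (isCoseparator_coseparator _) F'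
  have e : eC.functor ⋙ F' ⋙ eD.inverse ≅ F :=
    Functor.isoWhiskerRight eC.unitIso.symm (F ⋙ eD.functor ⋙ eD.inverse) ≪≫
      Functor.isoWhiskerLeft F eD.unitIso.symm
  exact Functor.isRightAdjoint_of_iso e

instance isRightAdjoint_etalePushforward {T S : Scheme.{u}} (f : T ⟶ S) :
    (etalePushforward f).IsRightAdjoint :=
  have := preservesLimits_etalePushforward f
  isRightAdjoint_of_isGrothendieckAbelian.{u} _

/-- The pullback `f^*` of étale sheaves of abelian groups, left adjoint to `f_*`. -/
abbrev etalePullback {T S : Scheme.{u}} (f : T ⟶ S) :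
    Sheaf S.smallEtaleTopology Ab.{u} ⥤ Sheaf T.smallEtaleTopology Ab.{u} :=
  (etaleBaseChange f).sheafPullback Ab.{u} S.smallEtaleTopology T.smallEtaleTopology

/-- A sheaf of abelian groups `F` on `S_et` is *locally constant constructible* if, locally for the
étale topology on `S`, it is isomorphic to the constant sheaf with value a finite abelian group. -/
def IsLCC {S : Scheme.{u}} (F : Sheaf S.smallEtaleTopology Ab.{u}) : Prop :=
  ∀ x : S, ∃ (U : Scheme.{u}) (j : U ⟶ S) (_ : Etale j) (A : Ab.{u}),
    x ∈ Set.range j ∧ Finite A ∧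
      Nonempty ((etalePullback j).obj F ≅ (constantSheaf U.smallEtaleTopology Ab.{u}).obj A)

/-- For `π : T ⟶ S`, the property defining the full subcategory `C(T/S)` of sheaves of abelian
groups on `S_et`: locally constant constructible, and constant after pullback to `T_et`. -/
def lccConstantOn {T S : Scheme.{u}} (π : T ⟶ S) :
    ObjectProperty (Sheaf S.smallEtaleTopology Ab.{u}) :=
  fun F => IsLCC F ∧ Sheaf.IsConstant T.smallEtaleTopology ((etalePullback π).obj F)

end EtaleSheaves

section Quotient

variable {G : Type*} [Group G] {Z : Scheme.{u}} (ρ : G →* Aut Z)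

/-- The subring `Γ(Z, 𝒪_Z)^G` of `G`-invariant global functions. -/
def invariantSections : Subring Γ(Z, ⊤) where
  carrier := {a | ∀ g : G, (ρ g).hom.appTop.hom a = a}
  mul_mem' ha hb g := by rw [map_mul, ha g, hb g]
  one_mem' g := map_one _
  add_mem' ha hb g := by rw [map_add, ha g, hb g]
  zero_mem' g := map_zero _
  neg_mem' ha g := by rw [map_neg, ha g]

/-- The quotient `Z/G = Spec (Γ(Z, 𝒪_Z)^G)` of an affine scheme `Z` by the action of a finite
group `G`. (Only meant for `Z` affine and `G` finite.) -/
abbrev quotient : Scheme.{u} := Spec (.of (invariantSections ρ))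

/-- The quotient map `Z ⟶ Z/G`. -/
def quotientMk : Z ⟶ quotient ρ :=
  Z.toSpecΓ ≫ Spec.map (CommRingCat.ofHom (invariantSections ρ).subtype)

variable {ρ} in
lemma appTop_mem_invariantSections {X : Scheme.{u}} {f : Z ⟶ X} (hf : ∀ g, (ρ g).hom ≫ f = f)
    (a : Γ(X, ⊤)) : f.appTop.hom a ∈ invariantSections ρ := fun g => by
  have h := congrArg (fun h : Z ⟶ X => h.appTop.hom a) (hf g)
  simp only [Scheme.Hom.comp_appTop] at h
  exact h

/-- The morphism `Z/G ⟶ X` to an affine scheme `X` induced by a `G`-invariant morphism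
`f : Z ⟶ X`. -/
def quotientDesc {X : Scheme.{u}} [IsAffine X] (f : Z ⟶ X) (hf : ∀ g, (ρ g).hom ≫ f = f) :
    quotient ρ ⟶ X :=
  Spec.map (CommRingCat.ofHom (f.appTop.hom.codRestrict (invariantSections ρ)
    (appTop_mem_invariantSections hf))) ≫ X.isoSpec.inv

lemma quotientMk_desc {X : Scheme.{u}} [IsAffine X] (f : Z ⟶ X) (hf : ∀ g, (ρ g).hom ≫ f = f) :
    quotientMk ρ ≫ quotientDesc ρ f hf = f := by
  have h : CommRingCat.ofHom (f.appTop.hom.codRestrict (invariantSections ρ)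
      (appTop_mem_invariantSections hf)) ≫
        CommRingCat.ofHom (invariantSections ρ).subtype = f.appTop := rfl
  rw [quotientMk, quotientDesc, Category.assoc, ← Spec.map_comp_assoc, h,
    ← Scheme.toSpecΓ_naturality_assoc]
  simp [Scheme.isoSpec]

end Quotient

section Galois

variable {k : Type u} [Field k] {X Xt : Scheme.{u}} {G : Type*} [Group G]

/-- `π : Xt ⟶ X`, with the group `G` acting on `Xt` over `X` through `ρ`, is an *étale Galois
covering with Galois group `G`*: `π` is finite étale and surjective and
`∐_{g ∈ G} Xt ⟶ Xt ×_X Xt`, `(g, x) ↦ (x, g x)`, is an isomorphism. -/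
structure IsGaloisCovering [Finite G] (π : Xt ⟶ X) (ρ : G →* Aut (Over.mk π)) : Prop where
  etale : Etale π
  isFinite : IsFinite π
  surjective : Surjective π
  isIso : IsIso (Sigma.desc fun g : G =>
    pullback.lift (f := π) (g := π) (𝟙 Xt) (ρ g).hom.left
      (by simpa using (Over.w (ρ g).hom).symm))

/-- The square `Xt ×_k Xt` of `Xt` regarded as a `k`-scheme via `Xt ⟶ X ⟶ Spec k`. -/
abbrev square (s : X ⟶ Spec (.of k)) (π : Xt ⟶ X) : Scheme.{u} := pullback (π ≫ s) (π ≫ s)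

/-- The endomorphism `a ×_k a` of `Xt ×_k Xt` induced by an endomorphism `a` of `Xt` over `X`. -/
def squareMap (s : X ⟶ Spec (.of k)) (π : Xt ⟶ X) (a : Over.mk π ⟶ Over.mk π) :
    square s π ⟶ square s π :=
  pullback.lift (pullback.fst (π ≫ s) (π ≫ s) ≫ a.left) (pullback.snd (π ≫ s) (π ≫ s) ≫ a.left) (by
    have h : a.left ≫ π = π := Over.w a
    rw [Category.assoc, Category.assoc, reassoc_of% h, pullback.condition])

@[simp]
lemma squareMap_fst (s : X ⟶ Spec (.of k)) (π : Xt ⟶ X) (a : Over.mk π ⟶ Over.mk π) :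
    squareMap s π a ≫ pullback.fst (π ≫ s) (π ≫ s) = pullback.fst (π ≫ s) (π ≫ s) ≫ a.left :=
  pullback.lift_fst _ _ _

@[simp]
lemma squareMap_snd (s : X ⟶ Spec (.of k)) (π : Xt ⟶ X) (a : Over.mk π ⟶ Over.mk π) :
    squareMap s π a ≫ pullback.snd (π ≫ s) (π ≫ s) = pullback.snd (π ≫ s) (π ≫ s) ≫ a.left :=
  pullback.lift_snd _ _ _

lemma squareMap_id (s : X ⟶ Spec (.of k)) (π : Xt ⟶ X) :
    squareMap s π (𝟙 (Over.mk π)) = 𝟙 (square s π) := by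
  apply pullback.hom_ext
  · rw [squareMap_fst, Over.id_left, Category.id_comp]
    exact Category.comp_id _
  · rw [squareMap_snd, Over.id_left, Category.id_comp]
    exact Category.comp_id _

lemma squareMap_comp (s : X ⟶ Spec (.of k)) (π : Xt ⟶ X) (a b : Over.mk π ⟶ Over.mk π) :
    squareMap s π (a ≫ b) = squareMap s π a ≫ squareMap s π b := by
  apply pullback.hom_ext
  · rw [squareMap_fst, Category.assoc, squareMap_fst, ← Category.assoc, squareMap_fst,
      Over.comp_left, Category.assoc]
  · rw [squareMap_snd, Category.assoc, squareMap_snd, ← Category.assoc, squareMap_snd,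
      Over.comp_left, Category.assoc]

/-- The diagonal action of `G` on `Xt ×_k Xt`. -/
def diagonalAction (s : X ⟶ Spec (.of k)) (π : Xt ⟶ X) (ρ : G →* Aut (Over.mk π)) :
    G →* Aut (square s π) where
  toFun g :=
    { hom := squareMap s π (ρ g).hom
      inv := squareMap s π (ρ g).inv
      hom_inv_id := (squareMap_comp s π _ _).symm.trans
        ((congrArg (squareMap s π) (Iso.hom_inv_id (ρ g))).trans (squareMap_id s π))
      inv_hom_id := (squareMap_comp s π _ _).symm.trans
        ((congrArg (squareMap s π) (Iso.inv_hom_id (ρ g))).trans (squareMap_id s π)) }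
  map_one' := by
    ext1
    rw [map_one]
    exact squareMap_id s π
  map_mul' g h := by
    ext1
    rw [map_mul]
    exact squareMap_comp s π _ _

variable (s : X ⟶ Spec (.of k)) (π : Xt ⟶ X) (ρ : G →* Aut (Over.mk π))

/-- The scheme `Y = (Xt ×_k Xt)/G`. -/
abbrev diagonalQuotient : Scheme.{u} := quotient (diagonalAction s π ρ)

/-- The projection `p₁ : Y ⟶ X`, induced by `pr₁ : Xt ×_k Xt ⟶ Xt` modulo `G`, that is, by the
`G`-invariant morphism `π ∘ pr₁`. -/
def p₁ [IsAffine X] : diagonalQuotient s π ρ ⟶ X :=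
  quotientDesc (diagonalAction s π ρ) (pullback.fst (π ≫ s) (π ≫ s) ≫ π) fun g => by
    change squareMap s π (ρ g).hom ≫ pullback.fst (π ≫ s) (π ≫ s) ≫ π = _
    rw [← Category.assoc, squareMap_fst, Category.assoc]
    exact congrArg _ (Over.w (ρ g).hom)

/-- The projection `p₂ : Y ⟶ X`, induced by `pr₂ : Xt ×_k Xt ⟶ Xt` modulo `G`, that is, by the
`G`-invariant morphism `π ∘ pr₂`. -/
def p₂ [IsAffine X] : diagonalQuotient s π ρ ⟶ X :=
  quotientDesc (diagonalAction s π ρ) (pullback.snd (π ≫ s) (π ≫ s) ≫ π) fun g => by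
    change squareMap s π (ρ g).hom ≫ pullback.snd (π ≫ s) (π ≫ s) ≫ π = _
    rw [← Category.assoc, squareMap_snd, Category.assoc]
    exact congrArg _ (Over.w (ρ g).hom)

end Galois

end

end FiniteMonodromy

/-! Let `F` be a sheaf on `X_et` that becomes constant on the irreducible scheme `Xt`. Since `Xt`
covers `X` and any two maps to `Xt` over `X` differ locally by an element of `G`, `F` is governed by
its sections over `Xt` with their `G`-action: for every abelian sheaf `E` on `X_et`, evaluation at
`Xt` identifies `Hom(F, E)` with the equivariant maps `F(Xt) → E(Xt)` (`hom_ext_of_isGeneratedOver`,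
`exists_hom_of_isGeneratedOver`).

Take `E = p_{i,*} H` with `H` a sheaf on `Y_et`. By adjunction, `Hom(p_i^* F, H)` is the group of
equivariant maps from `F(Xt)` to `H(Xt ×_{X, p_i} Y)`. Galois descent (`isPullback_quotientMk`)
shows that `Xt ×_{X, p_i} Y` is `Xt ×_k Xt` as a scheme over `Y`, with first projection `pr_i`; the
action of `G` on the factor `Xt` corresponds to the diagonal action for both `i`. So the group does
not depend on `i`, naturally in `F` and `H`, and the Yoneda lemma gives `p_1^* ≅ p_2^*`
(`nonempty_iso_of_isGeneratedOver`). -/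

namespace FiniteMonodromy

/-! ### Morphisms out of a sheaf generated by its sections over a torsor-like object -/

section Site

open Opposite

universe v w

variable {C : Type w} [Category.{v} C] {J : GrothendieckTopology C} {T : C} {G : Type*}

/-- A presheaf `F` is *generated over `T`* if, locally on any object `V` over `T`, sections of `F`
come from sections over `T`, and if a nonzero section over `T` does not vanish on an object `V` over
`T` unless `V` is covered by the empty sieve. -/
structure IsGeneratedOver (J : GrothendieckTopology C) (T : C) (F : Cᵒᵖ ⥤ Ab.{u}) : Prop where
  locally_mem {V : C} (φ : V ⟶ T) (t : F.obj (op V)) : ∃ S ∈ J V, ∀ ⦃W : C⦄ (f : W ⟶ V), S f →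
    ∃ m : F.obj (op T), F.map f.op t = F.map (f ≫ φ).op m
  eq_zero {V : C} (φ : V ⟶ T) (m : F.obj (op T)) (h : F.map φ.op m = 0) : m = 0 ∨ ⊥ ∈ J V

/-- A family `a` of endomorphisms of `T` *generates the self-products of* `T` if `T` covers the
terminal object and two morphisms to `T` locally differ by some `a g`. -/
structure IsTorsorLike (J : GrothendieckTopology C) (a : G → (T ⟶ T)) : Prop where
  cover (U : C) : ∃ S ∈ J U, ∀ ⦃V : C⦄ (f : V ⟶ U), S f → Nonempty (V ⟶ T)
  graph {V : C} (φ ψ : V ⟶ T) : ∃ S ∈ J V, ∀ ⦃W : C⦄ (f : W ⟶ V), S f →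
    ∃ g, f ≫ ψ = f ≫ φ ≫ a g

variable {a : G → (T ⟶ T)} {F : Cᵒᵖ ⥤ Ab.{u}} {E : Cᵒᵖ ⥤ Ab.{u}}

lemma map_map_apply (F : Cᵒᵖ ⥤ Ab.{u}) {U V W : C} (f : V ⟶ U) (g : W ⟶ V) (x : F.obj (op U)) :
    F.map g.op (F.map f.op x) = F.map (g ≫ f).op x := by
  rw [op_comp, F.map_comp]; rfl

lemma isSheaf_forget (hE : Presheaf.IsSheaf J E) : Presieve.IsSheaf J (E ⋙ forget Ab.{u}) :=
  (isSheaf_iff_isSheaf_of_type _ _).1 (GrothendieckTopology.HasSheafCompose.isSheaf E hE)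

lemma eq_of_locally_eq (hE : Presheaf.IsSheaf J E) {U : C} {S : Sieve U} (hS : S ∈ J U)
    {x y : E.obj (op U)} (h : ∀ ⦃V : C⦄ (f : V ⟶ U), S f → E.map f.op x = E.map f.op y) :
    x = y :=
  ((isSheaf_forget hE).isSeparated S hS).ext fun _ f hf => h f hf

/-- The pairs `(φ, m)` which present the section `s` on `f : V ⟶ U`. -/
def Presents (F : Cᵒᵖ ⥤ Ab.{u}) {U V : C} (s : F.obj (op U)) (f : V ⟶ U) (φ : V ⟶ T)
    (m : F.obj (op T)) : Prop :=
  F.map f.op s = F.map φ.op m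

lemma Presents.comp {U V W : C} {s : F.obj (op U)} {f : V ⟶ U} {φ : V ⟶ T} {m : F.obj (op T)}
    (h : Presents F s f φ m) (g : W ⟶ V) : Presents F s (g ≫ f) (g ≫ φ) m := by
  unfold Presents at *
  rw [← map_map_apply, h, map_map_apply]

/-- The sieve on which a section is presented by a section over `T`. -/
def presentSieve (T : C) (F : Cᵒᵖ ⥤ Ab.{u}) {U : C} (s : F.obj (op U)) : Sieve U where
  arrows V f := ∃ (φ : V ⟶ T) (m : F.obj (op T)), Presents F s f φ m
  downward_closed := by
    rintro V W f ⟨φ, m, h⟩ g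
    exact ⟨g ≫ φ, m, h.comp g⟩

lemma presentSieve_mem (ha : IsTorsorLike J a) (hF : IsGeneratedOver J T F) {U : C}
    (s : F.obj (op U)) : presentSieve T F s ∈ J U := by
  obtain ⟨S, hS, h⟩ := ha.cover U
  refine J.transitive hS _ fun V f hf => ?_
  obtain ⟨φ⟩ := h f hf
  obtain ⟨S', hS', h'⟩ := hF.locally_mem φ (F.map f.op s)
  refine J.superset_covering (fun W g hg => ?_) hS'
  obtain ⟨m, hm⟩ := h' g hg
  exact ⟨g ≫ φ, m, by rw [Presents, ← map_map_apply, hm]⟩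

/-- Well-definedness of the extension of `h`. Locally `ψ` is `φ` followed by some `a g`, so `m` and
the translate of `n` by `a g` agree after restriction along `φ`. Either they are equal, and
equivariance of `h` concludes, or the object is covered by the empty sieve, where any two sections
of `E` coincide. -/
lemma eq_of_presents (ha : IsTorsorLike J a) (hF : IsGeneratedOver J T F)
    (hE : Presheaf.IsSheaf J E) {h : F.obj (op T) ⟶ E.obj (op T)}
    (hh : ∀ g m, h (F.map (a g).op m) = E.map (a g).op (h m)) {V : C} {φ ψ : V ⟶ T}
    {m n : F.obj (op T)} (e : F.map φ.op m = F.map ψ.op n) :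
    E.map φ.op (h m) = E.map ψ.op (h n) := by
  obtain ⟨S, hS, hS'⟩ := ha.graph φ ψ
  refine eq_of_locally_eq hE hS fun W f hf => ?_
  obtain ⟨g, hg⟩ := hS' f hf
  have h₁ : F.map (f ≫ φ).op (m - F.map (a g).op n) = 0 := by
    rw [map_sub, sub_eq_zero, map_map_apply, Category.assoc, ← hg, ← map_map_apply, e,
      map_map_apply]
  rw [map_map_apply, map_map_apply, hg]
  rcases hF.eq_zero _ _ h₁ with h₂ | h₂
  · rw [sub_eq_zero.1 h₂, hh, map_map_apply, Category.assoc]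
  · exact eq_of_locally_eq hE h₂ fun _ _ hf => hf.elim

/-- The image of `s` is forced wherever `s` is presented by some `(φ, m)`: it is `h m` restricted
along `φ`. By `eq_of_presents` these local values are independent of the choice and compatible, so
they glue. -/
lemma exists_section (ha : IsTorsorLike J a) (hF : IsGeneratedOver J T F)
    (hE : Presheaf.IsSheaf J E) {h : F.obj (op T) ⟶ E.obj (op T)}
    (hh : ∀ g m, h (F.map (a g).op m) = E.map (a g).op (h m)) {U : C} (s : F.obj (op U)) :
    ∃ e : E.obj (op U), ∀ ⦃V : C⦄ (f : V ⟶ U) (φ : V ⟶ T) (m : F.obj (op T)),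
      Presents F s f φ m → E.map f.op e = E.map φ.op (h m) := by
  classical
  have hE' := isSheaf_forget hE
  let x : Presieve.FamilyOfElements (E ⋙ forget Ab.{u}) (presentSieve T F s).arrows :=
    fun V f hf => E.map hf.choose.op (h hf.choose_spec.choose)
  have hx : ∀ {V : C} (f : V ⟶ U) (hf : presentSieve T F s f) (φ : V ⟶ T) (m : F.obj (op T)),
      Presents F s f φ m → x f hf = E.map φ.op (h m) := fun f hf φ m hm =>
    eq_of_presents ha hF hE hh (hf.choose_spec.choose_spec.symm.trans hm)
  have hc : x.Compatible := by
    intro Y₁ Y₂ Z g₁ g₂ f₁ f₂ h₁ h₂ e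
    obtain ⟨φ, m, h₁'⟩ := id h₁
    obtain ⟨ψ, n, h₂'⟩ := id h₂
    have e₁ := hx _ h₁ _ _ h₁'
    have e₂ := hx _ h₂ _ _ h₂'
    rw [e₁, e₂]
    change E.map g₁.op (E.map φ.op (h m)) = E.map g₂.op (E.map ψ.op (h n))
    rw [map_map_apply, map_map_apply]
    refine eq_of_presents ha hF hE hh ?_
    have := h₁'.comp g₁
    rw [e] at this
    exact this.symm.trans (h₂'.comp g₂)
  refine ⟨(hE' _ (presentSieve_mem ha hF s)).amalgamate x hc, fun V f φ m hm => ?_⟩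
  exact ((hE' _ (presentSieve_mem ha hF s)).valid_glue hc f ⟨φ, m, hm⟩).trans (hx _ _ _ _ hm)

lemma hom_ext_of_isGeneratedOver (ha : IsTorsorLike J a) (hF : IsGeneratedOver J T F)
    (hE : Presheaf.IsSheaf J E) {α β : F ⟶ E} (h : α.app (op T) = β.app (op T)) : α = β := by
  ext U s
  refine eq_of_locally_eq hE (presentSieve_mem ha hF s) fun V f ⟨φ, m, hm⟩ => ?_
  rw [← NatTrans.naturality_apply, ← NatTrans.naturality_apply, hm, NatTrans.naturality_apply,
    NatTrans.naturality_apply, h]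

lemma exists_hom_of_isGeneratedOver (ha : IsTorsorLike J a) (hF : IsGeneratedOver J T F)
    (hE : Presheaf.IsSheaf J E) {h : F.obj (op T) ⟶ E.obj (op T)}
    (hh : ∀ g m, h (F.map (a g).op m) = E.map (a g).op (h m)) :
    ∃ α : F ⟶ E, α.app (op T) = h := by
  choose e he using fun (U : C) (s : F.obj (op U)) => exists_section ha hF hE hh s
  have uniq {U : C} (s : F.obj (op U)) (x y : E.obj (op U))
      (hxy : ∀ ⦃V : C⦄ (f : V ⟶ U) (φ : V ⟶ T) (m : F.obj (op T)), Presents F s f φ m →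
        E.map f.op x = E.map f.op y) : x = y :=
    eq_of_locally_eq hE (presentSieve_mem ha hF s) fun V f ⟨φ, m, hm⟩ => hxy f φ m hm
  have add (U : C) (s t : F.obj (op U)) : e U (s + t) = e U s + e U t := by
    refine uniq s _ _ fun V f φ m hm => ?_
    -- To add presentations, `t` must be presented along the same `φ` as `s`; this is possible after
    -- refining the cover.
    obtain ⟨S, hS, hS'⟩ := hF.locally_mem φ (F.map f.op t)
    refine eq_of_locally_eq hE hS fun W g hg => ?_
    obtain ⟨n, hn⟩ := hS' g hg
    rw [map_map_apply] at hn
    have hn' : Presents F t (g ≫ f) (g ≫ φ) n := hn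
    have hst : Presents F (s + t) (g ≫ f) (g ≫ φ) (m + n) := by
      have := hm.comp g
      unfold Presents at *
      rw [map_add, map_add, this, hn']
    rw [map_map_apply, map_map_apply, he _ _ _ _ _ hst, map_add, map_add, map_add,
      he _ _ _ _ _ (hm.comp g), he _ _ _ _ _ hn']
  refine ⟨{ app := fun U => AddCommGrpCat.ofHom (AddMonoidHom.mk' (e U.unop) (add U.unop))
            naturality := fun U U' k => ?_ }, ?_⟩
  · ext s
    refine uniq (F.map k s) _ _ fun V f φ m hm => ?_
    change E.map f.op (e U'.unop (F.map k s)) = E.map f.op (E.map k.unop.op (e U.unop s))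
    rw [he _ _ _ _ _ hm, map_map_apply]
    refine (he _ _ _ _ _ ?_).symm
    exact (map_map_apply F k.unop f s).symm.trans hm
  · ext m
    refine uniq m _ _ fun V f φ n hn => ?_
    change E.map f.op (e T m) = _
    rw [he _ _ _ _ _ hn]
    exact (eq_of_presents ha hF hE hh hn).symm

end Site

/-! ### Comparing left adjoints through sections of the right adjoints -/

section Transfer

open Opposite

universe v w

/-- Yoneda: the images of identities under `e` and its inverse are mutually inverse, and naturality
in `F` makes them a natural transformation. -/
lemma nonempty_natIso_of_homEquiv {K D : Type*} [Category* K] [Category* D] {A B : K ⥤ D}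
    (e : ∀ (F : K) (H : D), (A.obj F ⟶ H) ≃ (B.obj F ⟶ H))
    (he : ∀ (F : K) {H H' : D} (x : A.obj F ⟶ H) (γ : H ⟶ H'), e F H' (x ≫ γ) = e F H x ≫ γ)
    (he' : ∀ {F F' : K} (β : F' ⟶ F) {H : D} (x : A.obj F ⟶ H),
      e F' H (A.map β ≫ x) = B.map β ≫ e F H x) : Nonempty (A ≅ B) := by
  have h₁ (F : K) : e F _ (𝟙 _) ≫ (e F (B.obj F)).symm (𝟙 _) = 𝟙 _ := by
    rw [← he, Category.id_comp, Equiv.apply_symm_apply]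
  refine ⟨Iso.symm <| NatIso.ofComponents (fun F =>
    { hom := e F _ (𝟙 _)
      inv := (e F _).symm (𝟙 _)
      hom_inv_id := h₁ F
      inv_hom_id := (e F _).injective (by rw [he, Equiv.apply_symm_apply, Category.id_comp]) })
    fun {F' F} β => ?_⟩
  rw [← he', ← he, Category.comp_id, Category.id_comp]

variable {C : Type w} [Category.{v} C] {J : GrothendieckTopology C} {T : C} {G : Type*}
  {a : G → (T ⟶ T)} {D : Type*} [Category* D]

/-- Two left adjoints to functors into a category of sheaves agree on the sheaves generated over `T`
as soon as the right adjoints have, equivariantly, the same sections over `T`. -/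
theorem nonempty_iso_of_isGeneratedOver (ha : IsTorsorLike J a)
    (P : ObjectProperty (Sheaf J Ab.{u})) (hP : ∀ F, P F → IsGeneratedOver J T F.obj)
    {L₁ L₂ : Sheaf J Ab.{u} ⥤ D} {R₁ R₂ : D ⥤ Sheaf J Ab.{u}} (adj₁ : L₁ ⊣ R₁) (adj₂ : L₂ ⊣ R₂)
    (θ : ∀ H : D, (R₁.obj H).obj.obj (op T) ≅ (R₂.obj H).obj.obj (op T))
    (hθ : ∀ {H H' : D} (γ : H ⟶ H'), (R₁.map γ).hom.app (op T) ≫ (θ H').hom =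
      (θ H).hom ≫ (R₂.map γ).hom.app (op T))
    (hθa : ∀ (H : D) (g : G), (R₁.obj H).obj.map (a g).op ≫ (θ H).hom =
      (θ H).hom ≫ (R₂.obj H).obj.map (a g).op) :
    Nonempty (P.ι ⋙ L₁ ≅ P.ι ⋙ L₂) := by
  have ext {F E : Sheaf J Ab.{u}} (hF : P F) {α β : F ⟶ E}
      (h : α.hom.app (op T) = β.hom.app (op T)) : α = β :=
    Sheaf.hom_ext (hom_ext_of_isGeneratedOver ha (hP F hF) E.property h)
  have ex {F E : Sheaf J Ab.{u}} (hF : P F) (h : F.obj.obj (op T) ⟶ E.obj.obj (op T))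
      (hh : ∀ g, F.obj.map (a g).op ≫ h = h ≫ E.obj.map (a g).op) :
      ∃ α : F ⟶ E, α.hom.app (op T) = h := by
    obtain ⟨α, hα⟩ := exists_hom_of_isGeneratedOver ha (hP F hF) E.property (h := h)
      fun g m => congrArg (fun k => k m) (hh g)
    exact ⟨⟨α⟩, hα⟩
  -- Composing the equivariant map on sections over `T` with `θ` keeps it equivariant, so it extends
  -- to a unique morphism to the other right adjoint.
  have h₁₂ (F : P.FullSubcategory) (H : D) (α : F.obj ⟶ R₁.obj H) :=
    ex (E := R₂.obj H) F.property (α.hom.app (op T) ≫ (θ H).hom) fun g => by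
      rw [← Category.assoc, α.hom.naturality, Category.assoc, hθa, Category.assoc]
  have h₂₁ (F : P.FullSubcategory) (H : D) (α : F.obj ⟶ R₂.obj H) :=
    ex (E := R₁.obj H) F.property (α.hom.app (op T) ≫ (θ H).inv) fun g => by
      rw [← Category.assoc, α.hom.naturality, Category.assoc, Category.assoc,
        (Iso.eq_inv_comp _).2
          ((Category.assoc _ _ _).symm.trans ((Iso.comp_inv_eq _).2 (hθa H g).symm))]
  choose t₁₂ ht₁₂ using h₁₂
  choose t₂₁ ht₂₁ using h₂₁
  let t (F : P.FullSubcategory) (H : D) : (F.obj ⟶ R₁.obj H) ≃ (F.obj ⟶ R₂.obj H) :=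
    { toFun := t₁₂ F H
      invFun := t₂₁ F H
      left_inv := fun α => ext F.property (by rw [ht₂₁, ht₁₂]; simp)
      right_inv := fun α => ext F.property (by rw [ht₁₂, ht₂₁]; simp) }
  refine nonempty_natIso_of_homEquiv (fun F H =>
    (adj₁.homEquiv F.obj H).trans ((t F H).trans (adj₂.homEquiv F.obj H).symm)) ?_ ?_
  · intro F H H' x γ
    change (adj₂.homEquiv _ _).symm (t₁₂ F H' (adj₁.homEquiv _ _ (x ≫ γ))) =
      (adj₂.homEquiv _ _).symm (t₁₂ F H (adj₁.homEquiv _ _ x)) ≫ γ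
    rw [adj₁.homEquiv_naturality_right, ← adj₂.homEquiv_naturality_right_symm]
    congr 1
    refine ext F.property ?_
    rw [ht₁₂]
    simp only [ObjectProperty.FullSubcategory.comp_hom, NatTrans.comp_app, Category.assoc, hθ]
    rw [← Category.assoc, ← ht₁₂]
  · intro F F' β H x
    change (adj₂.homEquiv _ _).symm (t₁₂ F' H (adj₁.homEquiv _ _ (L₁.map β.hom ≫ x))) =
      L₂.map β.hom ≫ (adj₂.homEquiv _ _).symm (t₁₂ F H (adj₁.homEquiv _ _ x))
    rw [adj₁.homEquiv_naturality_left, ← adj₂.homEquiv_naturality_left_symm]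
    congr 1
    refine ext F'.property ?_
    rw [ht₁₂]
    simp only [ObjectProperty.FullSubcategory.comp_hom, NatTrans.comp_app, Category.assoc, ht₁₂]

end Transfer

/-! ### Pullback along an étale morphism as restriction of the site -/

section EtaleMap

open Opposite

/-- Constructor for morphisms in the small étale site. -/
def etaleHomMk {S : Scheme.{u}} {U V : S.Etale} (f : U.left ⟶ V.left)
    (w : f ≫ V.hom = U.hom) : U ⟶ V :=
  MorphismProperty.Over.homMk f w trivial

lemma etale_w {S : Scheme.{u}} {U V : S.Etale} (f : U ⟶ V) : f.left ≫ V.hom = U.hom :=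
  Over.w ((Scheme.Etale.forget S).map f)

lemma etale_hom_ext {S : Scheme.{u}} {U V : S.Etale} {f g : U ⟶ V} (h : f.left = g.left) :
    f = g :=
  MorphismProperty.Over.Hom.ext h

lemma etale_comp_left {S : Scheme.{u}} {U V W : S.Etale} (f : U ⟶ V) (g : V ⟶ W) :
    (f ≫ g).left = f.left ≫ g.left := rfl

lemma mem_smallEtaleTopology_iff {S : Scheme.{u}} {U : S.Etale} (R : Sieve U) :
    R ∈ S.smallEtaleTopology U ↔
      ∀ x : U.left, ∃ (V : S.Etale) (f : V ⟶ U), R f ∧ x ∈ Set.range f.left := by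
  obtain ⟨ι, Z, g, rfl⟩ := R.exists_eq_ofArrows
  rw [Scheme.ofArrows_mem_smallEtaleTopology_iff, Set.eq_univ_iff_forall]
  refine forall_congr' fun x => ?_
  rw [Set.mem_iUnion]
  constructor
  · rintro ⟨i, hi⟩
    exact ⟨_, g i, Sieve.ofArrows_mk _ _ i, hi⟩
  · rintro ⟨V, f, hf, y, rfl⟩
    obtain ⟨i, k, rfl⟩ := (Sieve.mem_ofArrows_iff _ _ _).1 hf
    exact ⟨i, k.left y, by rw [etale_comp_left, Scheme.Hom.comp_apply]⟩

variable {S T : Scheme.{u}} (π : T ⟶ S) [Etale π]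

/-- Composition with an étale morphism `π : T ⟶ S`, as a functor `T_et ⥤ S_et`. -/
def etaleMap : T.Etale ⥤ S.Etale :=
  MorphismProperty.Over.map ⊤ (P := etaleProp) (f := π) ‹_›

/-- Composition with `π` is left adjoint to base change along `π`. -/
noncomputable def etaleMapAdj : etaleMap π ⊣ etaleBaseChange π :=
  MorphismProperty.Over.mapPullbackAdj etaleProp ⊤ π ‹_› trivial

/-- A scheme étale over `S`, with a factorization of its structure morphism through `T`, as a
scheme étale over `T`. -/
def etaleFactor {V : S.Etale} (φ : V.left ⟶ T) (hφ : φ ≫ π = V.hom) : T.Etale :=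
  haveI : Etale φ :=
    haveI : Etale (φ ≫ π) := by rw [hφ]; exact V.prop
    Etale.of_comp φ π
  Scheme.Etale.mk φ

variable {π}

/-- The inclusion of `etaleFactor π φ hφ`, mapped back to `S_et`. -/
def fromEtaleFactor {V : S.Etale} (φ : V.left ⟶ T) (hφ : φ ≫ π = V.hom) :
    (etaleMap π).obj (etaleFactor π φ hφ) ⟶ V :=
  etaleHomMk (𝟙 V.left) ((Category.id_comp _).trans hφ.symm)

/-- The inverse of `fromEtaleFactor`. -/
def toEtaleFactor {V : S.Etale} (φ : V.left ⟶ T) (hφ : φ ≫ π = V.hom) :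
    V ⟶ (etaleMap π).obj (etaleFactor π φ hφ) :=
  etaleHomMk (𝟙 V.left) ((Category.id_comp _).trans hφ)

lemma toEtaleFactor_fromEtaleFactor {V : S.Etale} (φ : V.left ⟶ T) (hφ : φ ≫ π = V.hom) :
    toEtaleFactor φ hφ ≫ fromEtaleFactor φ hφ = 𝟙 _ :=
  etale_hom_ext (Category.id_comp _)

variable (π)

/-- An object `V` over both `Y₁` and `Y₂` receives two maps to `T`. They agree because `g₁` and `g₂`
have the same target over `T`, so `V` is itself étale over `T`, and compatibility of the family on
`T_et` applies to it. -/
lemma compatiblePreserving_etaleMap :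
    CompatiblePreserving S.smallEtaleTopology (etaleMap π) where
  compatible ℱ Z R x hx Y₁ Y₂ V f₁ f₂ g₁ g₂ hg₁ hg₂ h := by
    let l₁ : V.left ⟶ Y₁.left := f₁.left
    let l₂ : V.left ⟶ Y₂.left := f₂.left
    have hl : l₁ ≫ g₁.left = l₂ ≫ g₂.left := congrArg (fun k => k.left) h
    have hl' : l₁ ≫ Y₁.hom = l₂ ≫ Y₂.hom := by
      rw [← etale_w g₁, ← etale_w g₂, reassoc_of% hl]
    have hφ : (l₁ ≫ Y₁.hom) ≫ π = V.hom := (Category.assoc _ _ _).trans (etale_w f₁)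
    let k₁ : etaleFactor π _ hφ ⟶ Y₁ := etaleHomMk l₁ rfl
    let k₂ : etaleFactor π _ hφ ⟶ Y₂ := etaleHomMk l₂ hl'.symm
    have e₁ : f₁ = toEtaleFactor _ hφ ≫ (etaleMap π).map k₁ :=
      etale_hom_ext (Category.id_comp _).symm
    have e₂ : f₂ = toEtaleFactor _ hφ ≫ (etaleMap π).map k₂ :=
      etale_hom_ext (Category.id_comp _).symm
    have := hx k₁ k₂ hg₁ hg₂ (etale_hom_ext hl)
    rw [e₁, e₂, op_comp, op_comp, ℱ.obj.map_comp, ℱ.obj.map_comp]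
    exact congrArg (ℱ.obj.map (toEtaleFactor _ hφ).op) this

lemma coverPreserving_etaleMap :
    CoverPreserving T.smallEtaleTopology S.smallEtaleTopology (etaleMap π) where
  cover_preserve {U R} hR := by
    rw [mem_smallEtaleTopology_iff] at hR ⊢
    intro x
    obtain ⟨V, f, hf, hx⟩ := hR x
    exact ⟨_, (etaleMap π).map f, Sieve.image_mem_functorPushforward _ _ hf, hx⟩

instance : (etaleMap π).IsContinuous T.smallEtaleTopology S.smallEtaleTopology :=
  Functor.isContinuous_of_coverPreserving (compatiblePreserving_etaleMap π)
    (coverPreserving_etaleMap π)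

/-- The pullback along an étale morphism `π` is the restriction along composition with `π`. -/
noncomputable def etalePullbackIso :
    etalePullback π ≅ (etaleMap π).sheafPushforwardContinuous Ab.{u}
      T.smallEtaleTopology S.smallEtaleTopology :=
  ((etaleBaseChange π).sheafAdjunctionContinuous Ab.{u} S.smallEtaleTopology
    T.smallEtaleTopology).leftAdjointUniq
      ((etaleMapAdj π).sheafPushforwardContinuous T.smallEtaleTopology S.smallEtaleTopology)

end EtaleMap

/-! ### Constant sheaves on an irreducible scheme -/

section Constant

open Opposite

universe v w

/-- A constant sheaf receives a locally bijective morphism from a constant presheaf. -/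
lemma exists_isLocallyBijective_of_isConstant {C : Type w} [Category.{v} C]
    (J : GrothendieckTopology C) [HasWeakSheafify J Ab.{u}] [J.WEqualsLocallyBijective Ab.{u}]
    (F : Sheaf J Ab.{u}) [hF : Sheaf.IsConstant J F] :
    ∃ (M : Ab.{u}) (c : (Functor.const Cᵒᵖ).obj M ⟶ F.obj),
      Presheaf.IsLocallyInjective J c ∧ Presheaf.IsLocallySurjective J c := by
  obtain ⟨M, ⟨i⟩⟩ := hF.mem_essImage
  have : IsIso i.hom.hom := inferInstanceAs (IsIso ((sheafToPresheaf J Ab.{u}).map i.hom))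
  let P := (Functor.const Cᵒᵖ).obj M
  let c₁ : P ⟶ ((constantSheaf J Ab.{u}).obj M).obj := toSheafify J P
  have h₁ : Presheaf.IsLocallyInjective J c₁ :=
    inferInstanceAs (Presheaf.IsLocallyInjective J (toSheafify J P))
  have h₂ : Presheaf.IsLocallySurjective J c₁ :=
    inferInstanceAs (Presheaf.IsLocallySurjective J (toSheafify J P))
  exact ⟨M, c₁ ≫ i.hom.hom, inferInstance, inferInstance⟩

variable {T : Scheme.{u}}

/-- The terminal morphism in the small étale site. -/
def toEtaleId (V : T.Etale) : V ⟶ Scheme.Etale.mk (𝟙 T) :=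
  etaleHomMk V.hom (Category.comp_id _)

lemma eq_toEtaleId {V : T.Etale} (φ : V ⟶ Scheme.Etale.mk (𝟙 T)) : φ = toEtaleId V :=
  etale_hom_ext ((Category.comp_id _).symm.trans (etale_w φ))

lemma bot_mem_smallEtaleTopology {V : T.Etale} (hV : IsEmpty V.left) :
    ⊥ ∈ T.smallEtaleTopology V :=
  (mem_smallEtaleTopology_iff _).2 fun x => hV.elim x

/-- Sections of a constant sheaf are locally restrictions of global sections. -/
lemma locally_mem_of_isConstant (F : Sheaf T.smallEtaleTopology Ab.{u})
    [Sheaf.IsConstant T.smallEtaleTopology F] {V : T.Etale} (t : F.obj.obj (op V)) :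
    ∃ R ∈ T.smallEtaleTopology V, ∀ ⦃W : T.Etale⦄ (f : W ⟶ V), R f →
      ∃ m : F.obj.obj (op (Scheme.Etale.mk (𝟙 T))),
        F.obj.map f.op t = F.obj.map (toEtaleId W).op m := by
  obtain ⟨M, c, -, hc⟩ := exists_isLocallyBijective_of_isConstant _ F
  refine ⟨_, Presheaf.imageSieve_mem _ c t, fun W f ⟨m, hm⟩ => ⟨c.app _ m, ?_⟩⟩
  rw [← hm, ← NatTrans.naturality_apply]
  rfl

/-- Étale morphisms are open, and two nonempty open subsets of an irreducible space meet. -/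
lemma nonempty_pullback_of_irreducibleSpace [IrreducibleSpace T] {V W : T.Etale}
    (hV : Nonempty V.left) (hW : Nonempty W.left) :
    Nonempty (pullback (toEtaleId V) (toEtaleId W)).left := by
  let f : V.left ⟶ T := V.hom
  let g : W.left ⟶ T := W.hom
  have : Etale f := V.prop
  have : Etale g := W.prop
  obtain ⟨x, ⟨v, hv⟩, ⟨w, hw⟩⟩ := nonempty_preirreducible_inter f.isOpenMap.isOpen_range
    g.isOpenMap.isOpen_range (Set.range_nonempty _) (Set.range_nonempty _)
  have sq := (IsPullback.of_hasPullback (toEtaleId V) (toEtaleId W)).map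
    (Scheme.Etale.forget T ⋙ Over.forget T)
  obtain ⟨y, -, -⟩ := Scheme.Pullback.exists_preimage_pullback v w (hv.trans hw.symm)
  exact ⟨sq.isoPullback.inv y⟩

/-- On an irreducible scheme, a section of a constant sheaf that vanishes somewhere vanishes. -/
lemma eq_zero_of_isConstant [IrreducibleSpace T] (F : Sheaf T.smallEtaleTopology Ab.{u})
    [Sheaf.IsConstant T.smallEtaleTopology F] {V : T.Etale} (hV : Nonempty V.left)
    (m : F.obj.obj (op (Scheme.Etale.mk (𝟙 T)))) (hm : F.obj.map (toEtaleId V).op m = 0) :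
    m = 0 := by
  obtain ⟨M, c, hi, hs⟩ := exists_isLocallyBijective_of_isConstant _ F
  -- Local injectivity makes `n` vanish on some member of a cover of `W`, which exists as `W` is
  -- nonempty; restriction in the constant presheaf is the identity, so `n` itself is zero.
  have key {W : T.Etale} (hW : Nonempty W.left) (n : M) (h : c.app (op W) n = 0) : n = 0 := by
    have := Presheaf.equalizerSieve_mem T.smallEtaleTopology c (X := op W) n (0 : M)
      (h.trans (map_zero _).symm)
    obtain ⟨W', f, hf, -⟩ := (mem_smallEtaleTopology_iff _).1 this hW.some
    exact hf
  refine eq_of_locally_eq F.property (Presheaf.imageSieve_mem _ c m) fun W f ⟨n, hn⟩ => ?_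
  rw [map_zero]
  by_cases hW : Nonempty W.left
  swap
  · exact eq_of_locally_eq F.property (bot_mem_smallEtaleTopology (not_nonempty_iff.1 hW))
      fun _ _ h => h.elim
  suffices h : n = (0 : M) by
    rw [← hn, h]
    exact map_zero _
  -- On `W ×_T V`, which is nonempty, the section induced by `n` is a restriction of `m` through
  -- `V`, hence zero.
  refine key (nonempty_pullback_of_irreducibleSpace hW hV) n ?_
  have h₁ : c.app (op (pullback (toEtaleId W) (toEtaleId V))) n =
      F.obj.map (pullback.fst (toEtaleId W) (toEtaleId V)).op (c.app (op W) n) := by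
    rw [← NatTrans.naturality_apply]; rfl
  rw [h₁]
  refine (congrArg _ hn).trans ?_
  rw [eq_toEtaleId f, map_map_apply, pullback.condition, ← map_map_apply, hm, map_zero]

end Constant

/-! ### The Galois covering as an object of the étale site of the base -/

section Covering

open Opposite

variable {X Xt : Scheme.{u}} {π : Xt ⟶ X} [Etale π]

variable (π) in
/-- The image of the terminal object of `Xt_et` in `X_et` is `Xt`. -/
def etaleMapIdIso : Scheme.Etale.mk π ≅ (etaleMap π).obj (Scheme.Etale.mk (𝟙 Xt)) where
  hom := etaleHomMk (𝟙 Xt) ((Category.id_comp _).trans (Category.id_comp π))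
  inv := etaleHomMk (𝟙 Xt) rfl
  hom_inv_id := etale_hom_ext (Category.id_comp _)
  inv_hom_id := etale_hom_ext (Category.id_comp _)

lemma exists_etaleMap_obj_iso {V : X.Etale} (φ : V ⟶ Scheme.Etale.mk π) :
    ∃ (V' : Xt.Etale) (i : V ⟶ (etaleMap π).obj V') (j : (etaleMap π).obj V' ⟶ V),
      i ≫ j = 𝟙 V ∧ (etaleMap π).map (toEtaleId V') = j ≫ φ ≫ (etaleMapIdIso π).hom ∧
        (Nonempty V.left → Nonempty V'.left) := by
  have hφ : φ.left ≫ π = V.hom := etale_w φ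
  exact ⟨etaleFactor π φ.left hφ, toEtaleFactor (π := π) φ.left hφ,
    fromEtaleFactor (π := π) φ.left hφ, toEtaleFactor_fromEtaleFactor (π := π) φ.left hφ,
    etale_hom_ext ((Category.id_comp _).trans (Category.comp_id _)).symm, id⟩

/-- Pullback along `π` is restriction along `etaleMap π`, and every object of `X_et` over `Xt` comes
from `Xt_et`. The two properties are therefore those of a constant sheaf on `Xt`, where `Xt` is the
terminal object. -/
lemma isGeneratedOver_of_isConstant [IrreducibleSpace Xt]
    (F : Sheaf X.smallEtaleTopology Ab.{u})
    (hF : Sheaf.IsConstant Xt.smallEtaleTopology ((etalePullback π).obj F)) :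
    IsGeneratedOver X.smallEtaleTopology (Scheme.Etale.mk π) F.obj := by
  let F' := ((etaleMap π).sheafPushforwardContinuous Ab.{u}
    Xt.smallEtaleTopology X.smallEtaleTopology).obj F
  have hF' : Sheaf.IsConstant Xt.smallEtaleTopology F' :=
    Sheaf.isConstant_congr _ ((etalePullbackIso π).app F)
  have loc {V : Xt.Etale} (t : F.obj.obj (op ((etaleMap π).obj V))) :
      ∃ R ∈ Xt.smallEtaleTopology V, ∀ ⦃W : Xt.Etale⦄ (f : W ⟶ V), R f →
        ∃ m : F.obj.obj (op ((etaleMap π).obj (Scheme.Etale.mk (𝟙 Xt)))),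
          F.obj.map ((etaleMap π).map f).op t = F.obj.map ((etaleMap π).map (toEtaleId W)).op m :=
    locally_mem_of_isConstant F' t
  have inj {V : Xt.Etale} (hV : Nonempty V.left)
      (m : F.obj.obj (op ((etaleMap π).obj (Scheme.Etale.mk (𝟙 Xt)))))
      (hm : F.obj.map ((etaleMap π).map (toEtaleId V)).op m = 0) : m = 0 :=
    eq_zero_of_isConstant F' hV m hm
  constructor
  · intro V φ t
    obtain ⟨V', i, j, hij, hj, -⟩ := exists_etaleMap_obj_iso φ
    obtain ⟨R, hR, h⟩ := loc (F.obj.map j.op t)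
    refine ⟨Sieve.pullback i (R.functorPushforward (etaleMap π)),
      X.smallEtaleTopology.pullback_stable _
        ((coverPreserving_etaleMap π).cover_preserve hR), ?_⟩
    rintro W f ⟨W', f', k, hf', hk⟩
    obtain ⟨m, hm⟩ := h f' hf'
    refine ⟨F.obj.map (etaleMapIdIso π).hom.op m, ?_⟩
    have e₁ : f = k ≫ (etaleMap π).map f' ≫ j := by
      rw [← Category.assoc, ← hk, Category.assoc, hij, Category.comp_id]
    have e₂ : (f ≫ φ) ≫ (etaleMapIdIso π).hom = k ≫ (etaleMap π).map (toEtaleId W') := by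
      have : toEtaleId W' = f' ≫ toEtaleId _ := (eq_toEtaleId _).symm
      rw [this, Functor.map_comp, hj, e₁]
      simp only [Category.assoc]
    rw [map_map_apply, e₂, ← map_map_apply, ← hm, map_map_apply, map_map_apply, e₁]
    simp only [Category.assoc]
  · intro V φ m hm
    by_cases hV : Nonempty V.left
    swap
    · exact Or.inr (bot_mem_smallEtaleTopology (not_nonempty_iff.1 hV))
    left
    obtain ⟨V', i, j, hij, hj, hV'⟩ := exists_etaleMap_obj_iso φ
    have := inj (hV' hV) (F.obj.map (etaleMapIdIso π).inv.op m) (by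
      rw [map_map_apply, hj, Category.assoc, Category.assoc, Iso.hom_inv_id, Category.comp_id,
        ← map_map_apply, hm, map_zero])
    have h := congrArg (F.obj.map (etaleMapIdIso π).hom.op) this
    rwa [map_map_apply, Iso.hom_inv_id, op_id, F.obj.map_id, ConcreteCategory.id_apply,
      map_zero] at h

/-- The endomorphism of `Xt`, as an object of `X_et`, defined by an endomorphism over `X`. -/
def etaleEnd (a : Over.mk π ⟶ Over.mk π) : Scheme.Etale.mk π ⟶ Scheme.Etale.mk π :=
  etaleHomMk a.left (Over.w a)

/-- A pair of maps `V ⟶ Xt` over `X` is a map from `V` to `Xt ×_X Xt`, a disjoint union of the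
graphs of the elements of `G`. The inverse images of the graphs cover `V`, and on the one indexed by
`g` the second map is the first followed by `g`. -/
lemma isTorsorLike_of_isGaloisCovering {G : Type*} [Group G] [Finite G] (ρ : G →* Aut (Over.mk π))
    (hπ : IsGaloisCovering π ρ) :
    IsTorsorLike X.smallEtaleTopology fun g => etaleEnd (ρ g).hom := by
  have := hπ.surjective
  have := hπ.isIso
  constructor
  · intro U
    have : Etale U.hom := U.prop
    let Z : X.Etale := Scheme.Etale.mk (pullback.fst U.hom π ≫ U.hom)
    let p₁ : Z ⟶ U := etaleHomMk (pullback.fst U.hom π) rfl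
    let p₂ : Z ⟶ Scheme.Etale.mk π := etaleHomMk (pullback.snd U.hom π) pullback.condition.symm
    refine ⟨Sieve.generate (Presieve.singleton p₁), (mem_smallEtaleTopology_iff _).2 fun x => ?_,
      ?_⟩
    · exact ⟨Z, p₁, Sieve.le_generate _ _ _ (Presieve.singleton_self p₁),
        (pullback.fst U.hom π).surjective x⟩
    · rintro V f ⟨W, h, k, hk, -⟩
      cases hk
      exact ⟨h ≫ p₂⟩
  · intro V φ ψ
    let l : V.left ⟶ Xt := φ.left
    let r : V.left ⟶ Xt := ψ.left
    have hl : l ≫ π = V.hom := etale_w φ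
    have hr : r ≫ π = V.hom := etale_w ψ
    let σ : G → (Xt ⟶ pullback π π) := fun g => pullback.lift (f := π) (g := π) (𝟙 Xt)
      (ρ g).hom.left (by simpa using (Over.w (ρ g).hom).symm)
    let d : (∐ fun _ : G => Xt) ⟶ pullback π π := Sigma.desc σ
    have : IsIso d := hπ.isIso
    have hd (g : G) : Sigma.ι _ g ≫ d = σ g := Sigma.ι_desc σ g
    -- Each graph is a coproduct inclusion followed by an isomorphism.
    have hσ (g : G) : Etale (σ g) := by
      rw [← hd]
      infer_instance
    have hσ₁ (g : G) : σ g ≫ pullback.fst π π = 𝟙 Xt := pullback.lift_fst _ _ _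
    have hσ₂ (g : G) : σ g ≫ pullback.snd π π = (ρ g).hom.left := pullback.lift_snd _ _ _
    let c : V.left ⟶ pullback π π := pullback.lift l r (hl.trans hr.symm)
    have hc₁ : c ≫ pullback.fst π π = l := pullback.lift_fst _ _ _
    have hc₂ : c ≫ pullback.snd π π = r := pullback.lift_snd _ _ _
    refine ⟨⟨fun W f => ∃ g, f ≫ ψ = f ≫ φ ≫ etaleEnd (ρ g).hom, ?_⟩,
      (mem_smallEtaleTopology_iff _).2 fun x => ?_, fun _ _ h => h⟩
    · rintro Y Z f ⟨g, hg⟩ k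
      exact ⟨g, by rw [Category.assoc, hg, Category.assoc]⟩
    · obtain ⟨g, y, hy⟩ : ∃ g, ∃ y, σ g y = c x := by
        obtain ⟨z, hz⟩ := d.surjective (c x)
        obtain ⟨g, y, rfl⟩ : ∃ (g : G) (y : Xt), Sigma.ι (fun _ : G => Xt) g y = z :=
          (sigmaOpenCover fun _ : G => Xt).exists_eq z
        exact ⟨g, y, by rw [← hd, Scheme.Hom.comp_apply, hz]⟩
      have : Etale V.hom := V.prop
      let W : X.Etale := Scheme.Etale.mk (pullback.fst c (σ g) ≫ V.hom)
      obtain ⟨w, hw, -⟩ := Scheme.Pullback.exists_preimage_pullback x y hy.symm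
      refine ⟨W, etaleHomMk (pullback.fst c (σ g)) rfl, ⟨g, etale_hom_ext ?_⟩, ⟨w, hw⟩⟩
      have h₁ : pullback.fst c (σ g) ≫ l = pullback.snd c (σ g) := by
        have := pullback.condition (f := c) (g := σ g) =≫ pullback.fst π π
        rwa [Category.assoc, Category.assoc, hc₁, hσ₁, Category.comp_id] at this
      have h₂ : pullback.fst c (σ g) ≫ r = pullback.snd c (σ g) ≫ (ρ g).hom.left := by
        have := pullback.condition (f := c) (g := σ g) =≫ pullback.snd π π
        rwa [Category.assoc, Category.assoc, hc₂, hσ₂] at this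
      change pullback.fst c (σ g) ≫ r = pullback.fst c (σ g) ≫ l ≫ (ρ g).hom.left
      rw [h₂, reassoc_of% h₁]

end Covering

/-! ### Galois descent for rings -/

section Descent

open TensorProduct

/-- Galois descent for rings: let the finite group `G` act on a ring `B`, Galois over `A`, and on a
`B`-algebra `R` compatibly, with invariants `R₀`. Then `R = R₀ ⊗_A B`. -/
theorem isPushout_of_isInvariant {A B R R₀ G : Type*} [CommRing A] [CommRing B] [CommRing R]
    [CommRing R₀] [Algebra A B] [Algebra A R] [Algebra A R₀] [Algebra B R] [Algebra R₀ R]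
    [IsScalarTower A B R] [IsScalarTower A R₀ R] [Group G] [Finite G]
    (b : G → B →+* B) (r : G → R →+* R)
    (hb : ∀ g h x, b h (b g x) = b (g * h) x) (hr : ∀ g h x, r h (r g x) = r (g * h) x)
    (hb_one : ∀ x, b 1 x = x) (hr_one : ∀ x, r 1 x = x)
    (hbr : ∀ g x, r g (algebraMap B R x) = algebraMap B R (b g x))
    (hA : ∀ x, (∀ g, b g x = x) → x ∈ Set.range (algebraMap A B))
    (hinj : Function.Injective (algebraMap R₀ R))
    (hR₀ : ∀ x, x ∈ Set.range (algebraMap R₀ R) ↔ ∀ g, r g x = x)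
    (s : Finset (B × B)) [DecidableEq G]
    (hs : ∀ g, ∑ i ∈ s, i.1 * b g i.2 = if g = 1 then 1 else 0) :
    Algebra.IsPushout A R₀ B R := by
  classical
  have := Fintype.ofFinite G
  -- The pairs `(x_i, y_i)` in `s` are dual bases for the trace: `∑ x_i Tr(x y_i) = x`, since after
  -- exchanging sums `hs` kills every term with `g ≠ 1`. The same identity holds in `R`.
  have hb₁ (x : B) : ∑ i ∈ s, i.1 * ∑ g, b g (x * i.2) = b 1 x := by
    simp only [map_mul, Finset.mul_sum]
    rw [Finset.sum_comm]
    calc _ = ∑ g, b g x * ∑ i ∈ s, i.1 * b g i.2 := by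
          refine Finset.sum_congr rfl fun g _ => ?_
          rw [Finset.mul_sum]
          exact Finset.sum_congr rfl fun i _ => by ring
      _ = _ := by simp [hs]
  have hr₂ (x : R) : ∑ i ∈ s, (∑ g, r g (x * algebraMap B R i.2)) * algebraMap B R i.1 = x := by
    simp only [map_mul, Finset.sum_mul]
    rw [Finset.sum_comm]
    calc _ = ∑ g, r g x * algebraMap B R (∑ i ∈ s, i.1 * b g i.2) := by
          refine Finset.sum_congr rfl fun g _ => ?_
          rw [map_sum, Finset.mul_sum]
          exact Finset.sum_congr rfl fun i _ => by rw [hbr, map_mul]; ring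
      _ = _ := by simp [hs, hr_one, apply_ite]
  have hB (x : B) : ∃ a, algebraMap A B a = ∑ g, b g x := hA _ fun h => by
    rw [map_sum]
    exact (Fintype.sum_congr _ _ fun g => hb g h x).trans
      (Equiv.sum_comp (Equiv.mulRight h) fun g => b g x)
  have hR (x : R) : ∃ a, algebraMap R₀ R a = ∑ g, r g x := (hR₀ _).2 fun h => by
    rw [map_sum]
    exact (Fintype.sum_congr _ _ fun g => hr g h x).trans
      (Equiv.sum_comp (Equiv.mulRight h) fun g => r g x)
  choose tB htB using hB
  choose tR htR using hR
  have tR_add (x y : R) : tR (x + y) = tR x + tR y := hinj <| by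
    simp [htR, Finset.sum_add_distrib]
  have tR_mul (a : R₀) (x : B) :
      tR (algebraMap R₀ R a * algebraMap B R x) = tB x • a := hinj <| by
    rw [htR, Algebra.smul_def, map_mul, ← IsScalarTower.algebraMap_apply A R₀ R,
      IsScalarTower.algebraMap_apply A B R, htB, map_sum, Finset.sum_mul]
    refine Finset.sum_congr rfl fun g _ => ?_
    rw [map_mul, (hR₀ _).1 ⟨a, rfl⟩ g, hbr, mul_comm]
  let μ : R₀ ⊗[A] B →ₗ[A] R := TensorProduct.lift
    (((Algebra.linearMap R₀ <| Module.End R₀ (B →ₗ[A] R)).flip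
      (IsScalarTower.toAlgHom A B R).toLinearMap).restrictScalars A)
  have hμ (a : R₀) (x : B) : μ (a ⊗ₜ x) = algebraMap R₀ R a * algebraMap B R x :=
    Algebra.smul_def a (algebraMap B R x)
  -- The inverse of multiplication `R₀ ⊗ B → R` is the dual basis expansion `x ↦ ∑ Tr(x y_i) ⊗ x_i`.
  let ψ (x : R) : R₀ ⊗[A] B := ∑ i ∈ s, tR (x * algebraMap B R i.2) ⊗ₜ[A] i.1
  have hψ (z : R₀ ⊗[A] B) : ψ (μ z) = z := by
    induction z with
    | zero =>
      have h₀ : tR 0 = 0 := hinj <| by simp [htR]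
      simp [ψ, h₀]
    | add x y hx hy =>
      rw [map_add]
      refine Eq.trans ?_ (congrArg₂ (· + ·) hx hy)
      simp only [ψ, add_mul, tR_add, TensorProduct.add_tmul, Finset.sum_add_distrib]
    | tmul a x =>
      have (i : B × B) : tR (μ (a ⊗ₜ x) * algebraMap B R i.2) ⊗ₜ[A] i.1 =
          a ⊗ₜ[A] (i.1 * ∑ g, b g (x * i.2)) := by
        rw [hμ, mul_assoc, ← map_mul, tR_mul, TensorProduct.smul_tmul, Algebra.smul_def, htB,
          mul_comm]
      simp only [ψ, this]
      rw [← TensorProduct.tmul_sum, hb₁, hb_one]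
  refine ⟨⟨Function.LeftInverse.injective hψ, fun x => ⟨ψ x, ?_⟩⟩⟩
  change μ (ψ x) = x
  simp only [ψ, map_sum, hμ, htR]
  exact hr₂ x

end Descent

/-! ### Functions on a disjoint union of copies of a scheme -/

section Functions

lemma sigma_ext {G : Type*} [Finite G] {Z : Scheme.{u}} {x y : Γ(∐ fun _ : G => Z, ⊤)}
    (h : ∀ g, (Sigma.ι (fun _ : G => Z) g).appTop x = (Sigma.ι (fun _ : G => Z) g).appTop y) :
    x = y :=
  Scheme.OpenCover.ext_elem x y (sigmaOpenCover fun _ : G => Z) h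

/-- The indicator is the pullback of the idempotent `(1, 0)` of `Γ(Z, ⊤) × Γ(Z, ⊤)` along the map
given by the first factor on the component `1` and by the second on all others. -/
lemma exists_sigma_indicator {G : Type*} [Group G] [Finite G] (Z : Scheme.{u}) [DecidableEq G] :
    ∃ e : Γ(∐ fun _ : G => Z, ⊤), ∀ g, (Sigma.ι (fun _ : G => Z) g).appTop e =
      if g = 1 then 1 else 0 := by
  let R : CommRingCat.{u} := .of (Γ(Z, ⊤) × Γ(Z, ⊤))
  let φ (g : G) : R ⟶ Γ(Z, ⊤) :=
    CommRingCat.ofHom (if g = 1 then RingHom.fst _ _ else RingHom.snd _ _)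
  let t : (∐ fun _ : G => Z) ⟶ Spec R := Sigma.desc fun g => Z.toSpecΓ ≫ Spec.map (φ g)
  refine ⟨t.appTop ((Scheme.ΓSpecIso R).inv (1, 0)), fun g => ?_⟩
  have h : Sigma.ι (fun _ : G => Z) g ≫ t = Z.toSpecΓ ≫ Spec.map (φ g) := Sigma.ι_desc _ _
  have h' := congrArg (fun f : Z ⟶ Spec R => f.appTop ((Scheme.ΓSpecIso R).inv (1, 0))) h
  simp only [Scheme.Hom.comp_appTop] at h'
  refine h'.trans ?_
  have h₂ : (Scheme.ΓSpecIso R).inv ≫ (Spec.map (φ g)).appTop ≫ Z.toSpecΓ.appTop = φ g := by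
    rw [← Scheme.ΓSpecIso_inv_naturality_assoc]
    simp
  refine (congrArg (fun f => f.hom ((1, 0) : Γ(Z, ⊤) × Γ(Z, ⊤))) h₂).trans ?_
  by_cases hg : g = 1
  · simp only [φ, if_pos hg]
    rfl
  · simp only [φ, if_neg hg]
    rfl

end Functions

/-! ### The quotient square of an equivariant affine scheme over the covering -/

section GaloisCovering

open TensorProduct

variable {X Xt : Scheme.{u}} {G : Type*} [Group G] {π : Xt ⟶ X}

/-- The action of `g` on `Xt`, as a morphism of schemes. -/
def actHom (ρ : G →* Aut (Over.mk π)) (g : G) : Xt ⟶ Xt := (ρ g).hom.left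

lemma actHom_comp (ρ : G →* Aut (Over.mk π)) (g : G) : actHom ρ g ≫ π = π := Over.w (ρ g).hom

lemma actHom_one (ρ : G →* Aut (Over.mk π)) : actHom ρ 1 = 𝟙 Xt := by
  rw [actHom, map_one]; rfl

lemma actHom_mul (ρ : G →* Aut (Over.mk π)) (g h : G) :
    actHom ρ (g * h) = actHom ρ h ≫ actHom ρ g := by
  rw [actHom, map_mul]; rfl

/-- Global functions turn `∐ Xt ≅ Xt ×_X Xt` into an isomorphism from the tensor square onto
functions on `∐ Xt`. The `κ g` are its components, and the last element corresponds to the indicator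
of the component `1`. -/
lemma exists_tensor_ringHom [Finite G] [IsAffine X] {ρ : G →* Aut (Over.mk π)}
    (hπ : IsGaloisCovering π ρ) [Algebra Γ(X, ⊤) Γ(Xt, ⊤)]
    (halg : algebraMap Γ(X, ⊤) Γ(Xt, ⊤) = π.appTop.hom) [DecidableEq G] :
    ∃ κ : G → (Γ(Xt, ⊤) ⊗[Γ(X, ⊤)] Γ(Xt, ⊤) →+* Γ(Xt, ⊤)),
      (∀ g x y, κ g (x ⊗ₜ y) = x * (actHom ρ g).appTop y) ∧
      (∀ z z', (∀ g, κ g z = κ g z') → z = z') ∧ ∃ z, ∀ g, κ g z = if g = 1 then 1 else 0 := by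
  have := hπ.isFinite
  have : IsAffine Xt := isAffine_of_isAffineHom π
  let σ : G → (Xt ⟶ pullback π π) := fun g => pullback.lift (f := π) (g := π) (𝟙 Xt)
    (actHom ρ g) (by rw [actHom_comp, Category.id_comp])
  have hσ₁ (g : G) : σ g ≫ pullback.fst π π = 𝟙 Xt := pullback.lift_fst _ _ _
  have hσ₂ (g : G) : σ g ≫ pullback.snd π π = actHom ρ g := pullback.lift_snd _ _ _
  let d : (∐ fun _ : G => Xt) ⟶ pullback π π := Sigma.desc σ
  have : IsIso d := hπ.isIso
  have hd (g : G) : Sigma.ι _ g ≫ d = σ g := Sigma.ι_desc σ g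
  have q := CommRingCat.isPushout_tensorProduct Γ(X, ⊤) Γ(Xt, ⊤) Γ(Xt, ⊤)
  have p := isPushout_appTop_of_isPullback (IsPullback.of_hasPullback π π)
  have hA : CommRingCat.ofHom (algebraMap Γ(X, ⊤) Γ(Xt, ⊤)) = π.appTop := by rw [halg]; rfl
  rw [hA] at q
  let i := q.isoIsPushout _ _ p
  have hi₁ (x : Γ(Xt, ⊤)) : i.hom (x ⊗ₜ 1) = (pullback.fst π π).appTop x :=
    congrArg (fun f => f.hom x) (q.inl_isoIsPushout_hom _ _ p)
  have hi₂ (x : Γ(Xt, ⊤)) : i.hom (1 ⊗ₜ x) = (pullback.snd π π).appTop x :=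
    congrArg (fun f => f.hom x) (q.inr_isoIsPushout_hom _ _ p)
  have hi (z) : i.hom (i.inv z) = z := congrArg (fun f => f.hom z) i.inv_hom_id
  have hi' (z) : i.inv (i.hom z) = z := congrArg (fun f => f.hom z) i.hom_inv_id
  have hd' (z) : d.appTop ((inv d).appTop z) = z := by
    rw [← CommRingCat.comp_apply, ← Scheme.Hom.comp_appTop, IsIso.hom_inv_id]; rfl
  have hd'' (z) : (inv d).appTop (d.appTop z) = z := by
    rw [← CommRingCat.comp_apply, ← Scheme.Hom.comp_appTop, IsIso.inv_hom_id]; rfl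
  have hds (g : G) (z) : (σ g).appTop z = (Sigma.ι (fun _ : G => Xt) g).appTop (d.appTop z) := by
    rw [← hd, Scheme.Hom.comp_appTop, CommRingCat.comp_apply]
  refine ⟨fun g => (σ g).appTop.hom.comp i.hom.hom, fun g x y => ?_, fun z z' h => ?_, ?_⟩
  · have e : x ⊗ₜ[Γ(X, ⊤)] y = (x ⊗ₜ 1) * (1 ⊗ₜ y) := by simp
    change (σ g).appTop (i.hom (x ⊗ₜ[Γ(X, ⊤)] y)) = _
    rw [e, map_mul, map_mul, hi₁, hi₂, ← CommRingCat.comp_apply, ← CommRingCat.comp_apply,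
      ← Scheme.Hom.comp_appTop, ← Scheme.Hom.comp_appTop, hσ₁, hσ₂]
    rfl
  · have h₁ : d.appTop (i.hom z) = d.appTop (i.hom z') := sigma_ext fun g => by
      rw [← hds, ← hds]; exact h g
    rw [← hi' z, ← hd'' (i.hom z), h₁, hd'', hi']
  · obtain ⟨e, he⟩ := exists_sigma_indicator (G := G) Xt
    refine ⟨i.inv ((inv d).appTop e), fun g => ?_⟩
    change (σ g).appTop (i.hom (i.inv _)) = _
    rw [hi, hds, hd', he]

/-- A morphism from an affine scheme with an action of `G` to `Xt`, equivariant, exhibits it as the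
base change of `Xt` to its quotient. -/
theorem isPullback_quotientMk [Finite G] [IsAffine X] {ρ : G →* Aut (Over.mk π)}
    (hπ : IsGaloisCovering π ρ) {Z : Scheme.{u}} [IsAffine Z] (σ : G →* Aut Z) (p : Z ⟶ Xt)
    (hp : ∀ g, (σ g).hom ≫ p = p ≫ actHom ρ g) (hf : ∀ g, (σ g).hom ≫ p ≫ π = p ≫ π) :
    IsPullback p (quotientMk σ) π (quotientDesc σ (p ≫ π) hf) := by
  classical
  have := hπ.isFinite
  have := hπ.etale
  have := hπ.surjective
  have : IsAffine Xt := isAffine_of_isAffineHom π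
  let γ := p.appTop.hom.comp π.appTop.hom
  let δ : Γ(X, ⊤) →+* invariantSections σ := γ.codRestrict _ fun a => by
    have := appTop_mem_invariantSections hf a
    rwa [Scheme.Hom.comp_appTop] at this
  let : Algebra Γ(X, ⊤) Γ(Xt, ⊤) := π.appTop.hom.toAlgebra
  let : Algebra Γ(X, ⊤) Γ(Z, ⊤) := γ.toAlgebra
  let : Algebra Γ(X, ⊤) (invariantSections σ) := δ.toAlgebra
  let : Algebra Γ(Xt, ⊤) Γ(Z, ⊤) := p.appTop.hom.toAlgebra
  have : IsScalarTower Γ(X, ⊤) Γ(Xt, ⊤) Γ(Z, ⊤) := .of_algebraMap_eq fun _ => rfl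
  have : IsScalarTower Γ(X, ⊤) (invariantSections σ) Γ(Z, ⊤) := .of_algebraMap_eq fun _ => rfl
  have hff : Module.FaithfullyFlat Γ(X, ⊤) Γ(Xt, ⊤) :=
    (Flat.flat_and_surjective_iff_faithfullyFlat_of_isAffine π).1 ⟨inferInstance, inferInstance⟩
  obtain ⟨κ, hκ, hinj, e, he⟩ := exists_tensor_ringHom hπ rfl
  -- Writing the idempotent of the unit component as a sum of pure tensors yields the dual bases
  -- needed for descent.
  obtain ⟨s, rfl⟩ := TensorProduct.exists_finset e
  have key : Algebra.IsPushout Γ(X, ⊤) (invariantSections σ) Γ(Xt, ⊤) Γ(Z, ⊤) := by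
    refine isPushout_of_isInvariant (fun g => (actHom ρ g).appTop.hom)
      (fun g => (σ g).hom.appTop.hom) ?_ ?_ ?_ ?_ ?_ ?_ Subtype.val_injective ?_ s ?_
    -- Pullback of functions reverses composition, whence the order `g * h`.
    · intro g h x
      rw [actHom_mul, Scheme.Hom.comp_appTop]; rfl
    · intro g h x
      have : (σ (g * h)).hom = (σ h).hom ≫ (σ g).hom := by rw [map_mul]; rfl
      rw [this, Scheme.Hom.comp_appTop]; rfl
    · intro x
      rw [actHom_one]; rfl
    · intro x
      rw [map_one]; rfl
    · intro g x
      exact congrArg (fun f : Z ⟶ Xt => f.appTop x) (hp g)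
    · intro x hx
      -- By faithfully flat descent, an `x` with `x ⊗ 1 = 1 ⊗ x` comes from `X`; under `κ g` this
      -- equality reads `x = g x`.
      have h := (Algebra.IsEffective.of_faithfullyFlat Γ(X, ⊤) Γ(Xt, ⊤)
        |>.eqLocus_includeLeft_includeRight)
      rw [← h]
      refine hinj _ _ fun g => ?_
      change κ g (x ⊗ₜ 1) = κ g (1 ⊗ₜ x)
      rw [hκ, hκ, map_one, mul_one, one_mul]
      exact (hx g).symm
    · intro x
      constructor
      · rintro ⟨y, rfl⟩
        exact y.2
      · intro h
        exact ⟨⟨x, h⟩, rfl⟩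
    · intro g
      rw [← he g, map_sum]
      exact Finset.sum_congr rfl fun i _ => (hκ g _ _).symm
  have sq := isPullback_SpecMap_of_isPushout _ _ _ _
    (CommRingCat.isPushout_of_isPushout Γ(X, ⊤) (invariantSections σ) Γ(Xt, ⊤) Γ(Z, ⊤))
  refine sq.flip.of_iso Z.isoSpec.symm Xt.isoSpec.symm (Iso.refl _) X.isoSpec.symm ?_ ?_ ?_ ?_
  · exact Scheme.isoSpec_inv_naturality p
  · have h : Z.isoSpec.symm.hom ≫ Z.toSpecΓ = 𝟙 _ := Z.isoSpec.inv_hom_id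
    rw [quotientMk, reassoc_of% h]
    exact Category.comp_id _
  · exact Scheme.isoSpec_inv_naturality π
  · rw [quotientDesc]
    exact (Category.id_comp _).symm

end GaloisCovering

/-! ### The two base changes of the covering to the quotient -/

section BaseChange

open Opposite

variable {X Xt Y Z : Scheme.{u}} {π : Xt ⟶ X} [Etale π]

/-- A cartesian square over `π` identifies its corner with the base change of `Xt`. -/
noncomputable def baseChangeHom {f : Y ⟶ X} {p : Z ⟶ Xt} {q : Z ⟶ Y} (sq : IsPullback p q π f) :
    Z ≅ ((etaleBaseChange f).obj (Scheme.Etale.mk π)).left :=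
  sq.isoPullback

lemma baseChangeHom_snd {f : Y ⟶ X} {p : Z ⟶ Xt} {q : Z ⟶ Y} (sq : IsPullback p q π f) :
    (baseChangeHom sq).hom ≫ ((etaleBaseChange f).obj (Scheme.Etale.mk π)).hom = q :=
  sq.isoPullback_hom_snd

lemma baseChangeHom_equivariant {f : Y ⟶ X} {p : Z ⟶ Xt} {q : Z ⟶ Y} (sq : IsPullback p q π f)
    {a : Over.mk π ⟶ Over.mk π} {c : Z ⟶ Z} (h₁ : c ≫ p = p ≫ a.left) (h₂ : c ≫ q = q) :
    (baseChangeHom sq).hom ≫ ((etaleBaseChange f).map (etaleEnd a)).left =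
      c ≫ (baseChangeHom sq).hom := by
  have e₁ : sq.isoPullback.hom ≫ pullback.fst π f = p := sq.isoPullback_hom_fst
  have e₂ : sq.isoPullback.hom ≫ pullback.snd π f = q := sq.isoPullback_hom_snd
  let l : pullback π f ⟶ pullback π f := ((etaleBaseChange f).map (etaleEnd a)).left
  have l₁ : l ≫ pullback.fst π f = pullback.fst π f ≫ a.left := pullback.lift_fst _ _ _
  have l₂ : l ≫ pullback.snd π f = pullback.snd π f := pullback.lift_snd _ _ _
  change sq.isoPullback.hom ≫ l = c ≫ sq.isoPullback.hom
  apply pullback.hom_ext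
  · rw [Category.assoc, Category.assoc, l₁, e₁, h₁, reassoc_of% e₁]
  · rw [Category.assoc, Category.assoc, l₂, e₂, h₂]

/-- Two base changes of `Xt` with the same underlying scheme are isomorphic. -/
noncomputable def baseChangeIso {f₁ f₂ : Y ⟶ X} {p₁ p₂ : Z ⟶ Xt} {q : Z ⟶ Y}
    (sq₁ : IsPullback p₁ q π f₁) (sq₂ : IsPullback p₂ q π f₂) :
    (etaleBaseChange f₁).obj (Scheme.Etale.mk π) ≅
      (etaleBaseChange f₂).obj (Scheme.Etale.mk π) :=
  MorphismProperty.Over.isoMk ((baseChangeHom sq₁).symm ≪≫ baseChangeHom sq₂) (by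
    rw [Iso.trans_hom, Category.assoc, baseChangeHom_snd, Iso.symm_hom, Iso.inv_comp_eq,
      baseChangeHom_snd])

lemma baseChangeIso_equivariant {f₁ f₂ : Y ⟶ X} {p₁ p₂ : Z ⟶ Xt} {q : Z ⟶ Y}
    (sq₁ : IsPullback p₁ q π f₁) (sq₂ : IsPullback p₂ q π f₂)
    {a : Over.mk π ⟶ Over.mk π} {c : Z ⟶ Z} (h₁ : c ≫ p₁ = p₁ ≫ a.left)
    (h₂ : c ≫ p₂ = p₂ ≫ a.left) (h : c ≫ q = q) :
    (etaleBaseChange f₁).map (etaleEnd a) ≫ (baseChangeIso sq₁ sq₂).hom =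
      (baseChangeIso sq₁ sq₂).hom ≫ (etaleBaseChange f₂).map (etaleEnd a) := by
  refine etale_hom_ext ?_
  have e₁ := baseChangeHom_equivariant sq₁ h₁ h
  have e₂ := baseChangeHom_equivariant sq₂ h₂ h
  rw [etale_comp_left, etale_comp_left]
  change _ ≫ (baseChangeHom sq₁).inv ≫ (baseChangeHom sq₂).hom =
    ((baseChangeHom sq₁).inv ≫ (baseChangeHom sq₂).hom) ≫ _
  rw [Category.assoc, e₂, Iso.eq_inv_comp, reassoc_of% e₁, Iso.hom_inv_id_assoc]

end BaseChange

lemma comp_quotientMk {G : Type*} [Group G] {Z : Scheme.{u}} (σ : G →* Aut Z) (g : G) :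
    (σ g).hom ≫ quotientMk σ = quotientMk σ := by
  have h : CommRingCat.ofHom (invariantSections σ).subtype ≫ (σ g).hom.appTop =
      CommRingCat.ofHom (invariantSections σ).subtype := by
    ext x
    exact x.2 g
  rw [quotientMk, Scheme.toSpecΓ_naturality_assoc, ← Spec.map_comp, h]

end FiniteMonodromy

theorem lemma7p3 {k : Type u} [Field k] {X Xt : Scheme.{u}} {G : Type*} [Group G] [Finite G]
    (s : X ⟶ Spec (.of k)) [IsAffine X] [IsIntegral X] [Smooth s] [IrreducibleSpace Xt]
    (π : Xt ⟶ X) (ρ : G →* Aut (Over.mk π)) (hπ : FiniteMonodromy.IsGaloisCovering π ρ) :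
    Nonempty
      ((FiniteMonodromy.lccConstantOn π).ι ⋙
          FiniteMonodromy.etalePullback (FiniteMonodromy.p₁ s π ρ) ≅
        (FiniteMonodromy.lccConstantOn π).ι ⋙
          FiniteMonodromy.etalePullback (FiniteMonodromy.p₂ s π ρ)) := by
  have := hπ.etale
  have := hπ.isFinite
  have : IsAffine Xt := isAffine_of_isAffineHom π
  let σ := FiniteMonodromy.diagonalAction s π ρ
  have h₁ (g : G) : (σ g).hom ≫ pullback.fst (π ≫ s) (π ≫ s) =
      pullback.fst (π ≫ s) (π ≫ s) ≫ FiniteMonodromy.actHom ρ g :=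
    FiniteMonodromy.squareMap_fst s π (ρ g).hom
  have h₂ (g : G) : (σ g).hom ≫ pullback.snd (π ≫ s) (π ≫ s) =
      pullback.snd (π ≫ s) (π ≫ s) ≫ FiniteMonodromy.actHom ρ g :=
    FiniteMonodromy.squareMap_snd s π (ρ g).hom
  have sq₁ : IsPullback (pullback.fst (π ≫ s) (π ≫ s)) (FiniteMonodromy.quotientMk σ) π
      (FiniteMonodromy.p₁ s π ρ) :=
    FiniteMonodromy.isPullback_quotientMk hπ σ _ h₁ _
  have sq₂ : IsPullback (pullback.snd (π ≫ s) (π ≫ s)) (FiniteMonodromy.quotientMk σ) π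
      (FiniteMonodromy.p₂ s π ρ) :=
    FiniteMonodromy.isPullback_quotientMk hπ σ _ h₂ _
  -- Both squares have the same corner `Xt ×_k Xt` and the same map to `Y`; only the projection to
  -- `Xt` differs. Hence the sections of `p_{1,*} H` and `p_{2,*} H` over `Xt` are identified,
  -- compatibly with `G`.
  let e := FiniteMonodromy.baseChangeIso sq₁ sq₂
  have he (g : G) := FiniteMonodromy.baseChangeIso_equivariant sq₁ sq₂ (a := (ρ g).hom)
    (h₁ g) (h₂ g) (FiniteMonodromy.comp_quotientMk σ g)
  refine FiniteMonodromy.nonempty_iso_of_isGeneratedOver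
    (FiniteMonodromy.isTorsorLike_of_isGaloisCovering ρ hπ) _
    (fun F hF => FiniteMonodromy.isGeneratedOver_of_isConstant F hF.2)
    (Functor.sheafAdjunctionContinuous _ _ _ _) (Functor.sheafAdjunctionContinuous _ _ _ _)
    (fun H => (H.obj.mapIso e.op).symm) ?_ ?_
  · intro H H' γ
    exact (γ.hom.naturality e.inv.op).symm
  · intro H g
    change H.obj.map ((FiniteMonodromy.etaleBaseChange _).map _).op ≫ H.obj.map e.inv.op =
      H.obj.map e.inv.op ≫ H.obj.map ((FiniteMonodromy.etaleBaseChange _).map _).op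
    rw [← Functor.map_comp, ← Functor.map_comp, ← op_comp, ← op_comp]
    congr 2
    rw [Iso.inv_comp_eq, ← Category.assoc, Iso.eq_comp_inv]
    exact he g
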